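/- Let $k\ge 1$, $a\ge 1$, $b\ge 0$ and $c\ge 1$ be integers. Let $\varphi$ be the Euler phi function, let $L_k=\operatorname{lcm}(1,\dots,k)$, and for a prime $p$ let $v_p$ denote the $p$-adic valuation. Define, for every positive integer $n$, $$g_{k,\varphi}(n)=\frac{\prod_{i=0}^{k}\varphi\big(b+a(n+ic)\big)}{\varphi\big(\operatorname{lcm}_{0\le i\le k}\{b+a(n+ic)\}\big)} .$$ Put $d=\gcd(a,b)$ and $a'=a/d$, and let $$Q_{k,a',c}=\frac{cL_k}{\eta_{2,k,a',c}\prod_{\text{prime } q\mid a'}q^{v_q(cL_k)}},$$ where (although the notation does not show it, $\eta_{2,k,a',c}$ may also depend on the parity of $d$) $$\eta_{2,k,a',c}=\begin{cases}2^{v_2(L_k)}, & \text{if } 2\nmid a' \text{ and } v_2(k+1)\ge v_2(L_k)\ge 2,\\ 2, & \text{if } (2\nmid a \text{ and } v_2(cL_k)=1), \text{ or } (k=3,\ 2\nmid a \text{ and } 2\mid c), \text{ or } (k=3,\ 2\nmid a' \text{ and } 2\mid d),\\ 1, & \text{otherwise.}\end{cases}$$ Then there is at most one odd prime $p\nmid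 a'$ with $v_p(k+1)\ge v_p(L_k)\ge 1$. The function $g_{k,\varphi}$ is periodic on the positive integers, that is, there is a positive integer $T$ with $g_{k,\varphi}(n+T)=g_{k,\varphi}(n)$ for all $n\ge 1$, and its smallest period equals $Q_{k,a',c}$ if there is no such prime $p$, and equals $Q_{k,a',c}/p^{v_p(L_k)}$ if such a prime $p$ exists. -/

import Mathlib

/-- `Lk k = lcm(1, …, k)`, with `Lk 0 = 1`. -/
def Lk (k : ℕ) : ℕ := (Finset.Icc 1 k).lcm id

/-- The function `g_{k,f}` attached to the progression `b + a m` with step `c`: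
`g_{k,f}(n) = (∏_{i=0}^{k} f(b + a(n + ic))) / f(lcm_{0 ≤ i ≤ k} (b + a(n + ic)))`,
defined at positive integers `n`. -/
def gFun (f : ℕ → ℚ) (k a b c : ℕ) (n : ℕ+) : ℚ :=
  (∏ i ∈ Finset.range (k + 1), f (b + a * ((n : ℕ) + i * c))) /
    f ((Finset.range (k + 1)).lcm (fun i => b + a * ((n : ℕ) + i * c)))

/-- `g_{k,φ}`, for the Euler phi function. -/
def gPhi (k a b c : ℕ) : ℕ+ → ℚ :=
  gFun (fun m => (Nat.totient m : ℚ)) k a b c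

/-- The power of `2` in the denominator of the period; here `d = gcd(a, b)` and
`a' = a / d`, an exact division. -/
def eta2 (k a b c : ℕ) : ℕ :=
  if ¬ 2 ∣ a / Nat.gcd a b ∧
      padicValNat 2 (Lk k) ≤ padicValNat 2 (k + 1) ∧ 2 ≤ padicValNat 2 (Lk k) then
    2 ^ padicValNat 2 (Lk k)
  else if (¬ 2 ∣ a ∧ padicValNat 2 (c * Lk k) = 1) ∨
      (k = 3 ∧ ¬ 2 ∣ a ∧ 2 ∣ c) ∨
      (k = 3 ∧ ¬ 2 ∣ a / Nat.gcd a b ∧ 2 ∣ Nat.gcd a b) then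
    2
  else 1

/-- `Q_{k,a',c}`, as a rational number, with exact division. -/
def Qval (k a b c : ℕ) : ℚ :=
  ((c * Lk k : ℕ) : ℚ) /
    ((eta2 k a b c : ℚ) *
      ∏ q ∈ (a / Nat.gcd a b).primeFactors, (q : ℚ) ^ padicValNat q (c * Lk k))

/-- `p` is an odd prime not dividing `a' = a / gcd(a, b)` such that
`v_p(k+1) ≥ v_p(L_k) ≥ 1`. -/
def IsExceptional (k a b p : ℕ) : Prop :=
  p.Prime ∧ p ≠ 2 ∧ ¬ p ∣ a / Nat.gcd a b ∧
    padicValNat p (Lk k) ≤ padicValNat p (k + 1) ∧ 1 ≤ padicValNat p (Lk k)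

/-- `P` is a period of the function `g` on the positive integers. -/
def IsPeriod (g : ℕ+ → ℚ) (P : ℕ+) : Prop := ∀ n : ℕ+, g (n + P) = g n

/-! Since φ(p^v) is the product of `phiRatio p j` over 1 ≤ j ≤ v, the prime p contributes to g the
product over j of `phiRatio p j ^ (N_j - 1)` (truncated subtraction), where N_j counts the terms
divisible by p^j. Two terms differ by a·c·m with 1 ≤ m ≤ k, so only prime powers dividing a·c·L_k
matter. A product of local factors with prime-power periods has period T exactly when each factor
does (`periodic_prod_iff`), so the problem is local.

If p ∣ a', all terms have the same p-valuation and the factor is constant. Otherwise let γ = v_p(c)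
and e = ⌊log_p k⌋ = v_p(L_k). The exponent of the local period is γ + e in general. It drops to γ if
p^e ∣ k+1, because sliding the window by c then preserves every relevant N_j. It drops to 0 if p = 2
and only level j = 1 can matter, since φ(2) = 1. Minimality is tested at an n making the first term
divisible by the highest relevant power of p. It remains to compare exponents with the closed form
(`padicValNat_mul_Lk`). -/

/-- The number of indices `i ≤ k` for which `q` divides `b + a (n + i c)`. -/
def divCount (k a b c q n : ℕ) : ℕ :=
  ((Finset.range (k + 1)).filter fun i => q ∣ b + a * (n + i * c)).card

/-- The ratio of `φ (p ^ j)` to `φ (p ^ (j - 1))`. -/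
def phiRatio (p j : ℕ) : ℕ := if j = 1 then p - 1 else p

/-- The contribution of the prime `p` to `g_{k,φ}`. -/
def localFactor (k a b c K p n : ℕ) : ℕ :=
  ∏ j ∈ Finset.Icc 1 K, phiRatio p j ^ (divCount k a b c (p ^ j) n - 1)

/-! ### Periods of functions on ℕ and of products -/

theorem Function.Periodic.natGcd {α : Type*} {f : ℕ → α} (m n : ℕ) :
    Function.Periodic f m → Function.Periodic f n → Function.Periodic f (Nat.gcd m n) := by
  induction m, n using Nat.gcd.induction with
  | H0 n => intro _ h; simpa using h
  | H1 m n hm ih =>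
    intro h1 h2
    rw [Nat.gcd_rec]
    refine ih (fun x => ?_) h1
    have h3 : Function.Periodic f (n / m * m) := by simpa using h1.nat_mul (n / m)
    rw [← h3 (x + n % m), add_assoc, Nat.mod_add_div', h2]

theorem Function.Periodic.of_dvd_nat {α : Type*} {f : ℕ → α} {m n : ℕ}
    (h : Function.Periodic f m) (hmn : m ∣ n) : Function.Periodic f n := by
  obtain ⟨t, rfl⟩ := hmn
  simpa [mul_comm] using h.nat_mul t

theorem periodic_iff_pow_dvd {α : Type*} {f : ℕ → α} {p X : ℕ} (hp : p.Prime)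
    (h : Function.Periodic f (p ^ X)) (h' : 1 ≤ X → ¬ Function.Periodic f (p ^ (X - 1))) (T : ℕ) :
    Function.Periodic f T ↔ p ^ X ∣ T := by
  refine ⟨fun hT => ?_, h.of_dvd_nat⟩
  obtain ⟨t, ht, hg⟩ := (Nat.dvd_prime_pow hp).1 (Nat.gcd_dvd_right T (p ^ X))
  have h1 := Function.Periodic.natGcd _ _ hT h
  rw [hg] at h1
  rcases ht.lt_or_eq with hlt | rfl
  · exact absurd (h1.of_dvd_nat (pow_dvd_pow p (by omega))) (h' (by omega))
  · rw [← hg]; exact Nat.gcd_dvd_left _ _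

/-- Multiplying T by the moduli of the other primes freezes their factors, which cancel because they
are nonzero. The multiplier is coprime to p, so it does not affect divisibility by a power of p. -/
theorem periodic_prod_iff {S : Finset ℕ} (hS : ∀ p ∈ S, p.Prime) (h : ℕ → ℕ → ℕ) (X : ℕ → ℕ)
    (h0 : ∀ p ∈ S, ∀ n, h p n ≠ 0)
    (hX : ∀ p ∈ S, ∀ T, Function.Periodic (h p) T ↔ p ^ X p ∣ T) (T : ℕ) :
    Function.Periodic (fun n => ∏ p ∈ S, h p n) T ↔ ∏ p ∈ S, p ^ X p ∣ T := by
  have hcop : ∀ p ∈ S, ∀ q ∈ S, p ≠ q → Nat.Coprime (p ^ X p) (q ^ X q) := fun p hp q hq hpq =>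
    Nat.Coprime.pow _ _ ((Nat.coprime_primes (hS p hp) (hS q hq)).2 hpq)
  constructor
  · intro hT
    refine Finset.prod_dvd_of_isRelPrime (fun p hp q hq hpq => ?_) (fun p hp => ?_)
    · exact Nat.coprime_iff_isRelPrime.1 (hcop p hp q hq hpq)
    · have hper : Function.Periodic (h p) (T * ∏ q ∈ S.erase p, q ^ X q) := by
        intro n
        have h1 := (hT.of_dvd_nat (dvd_mul_right T (∏ q ∈ S.erase p, q ^ X q))) n
        simp only [← Finset.mul_prod_erase S _ hp] at h1
        have h2 : ∏ q ∈ S.erase p, h q (n + T * ∏ q ∈ S.erase p, q ^ X q)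
            = ∏ q ∈ S.erase p, h q n := by
          refine Finset.prod_congr rfl fun q hq => ?_
          exact (hX q (Finset.mem_of_mem_erase hq) _).2
            ((Finset.dvd_prod_of_mem (fun q => q ^ X q) hq).trans (dvd_mul_left _ _)) n
        rw [h2] at h1
        exact Nat.eq_of_mul_eq_mul_right (Nat.pos_of_ne_zero (Finset.prod_ne_zero_iff.2
          fun q hq => h0 q (Finset.mem_of_mem_erase hq) n)) h1
      refine Nat.Coprime.dvd_of_dvd_mul_right ?_ ((hX p hp _).1 hper)
      refine Nat.Coprime.prod_right fun q hq => ?_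
      exact hcop p hp q (Finset.mem_of_mem_erase hq) (Finset.ne_of_mem_erase hq).symm
  · intro hT n
    refine Finset.prod_congr rfl fun p hp => ?_
    exact (hX p hp T).2 ((Finset.dvd_prod_of_mem (fun p => p ^ X p) hp).trans hT) n

/-! ### Counting the terms divisible by q -/

theorem divCount_periodic_of_dvd {k a b c q T : ℕ} (h : q ∣ a * T) :
    Function.Periodic (divCount k a b c q) T := by
  intro n
  unfold divCount
  congr 1
  refine Finset.filter_congr fun i _ => ?_
  have : b + a * (n + T + i * c) = b + a * (n + i * c) + a * T := by ring
  rw [this]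
  exact (Nat.dvd_add_left h)

/-- Sliding the window by c drops the term i = 0 and gains the term i = k + 1. -/
theorem divCount_add_step (k a b c q n : ℕ) :
    divCount k a b c q (n + c) + (if q ∣ b + a * n then 1 else 0) =
      divCount k a b c q n + (if q ∣ b + a * (n + (k + 1) * c) then 1 else 0) := by
  simp only [divCount, Finset.card_filter]
  have h := Finset.sum_range_succ' (fun i => if q ∣ b + a * (n + i * c) then 1 else 0) (k + 1)
  rw [Finset.sum_range_succ] at h
  rw [h]
  congr 1
  · refine Finset.sum_congr rfl fun i _ => ?_
    have : b + a * (n + c + i * c) = b + a * (n + (i + 1) * c) := by ring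
    rw [this]
  · simp

theorem divCount_periodic_step {k a b c q : ℕ} (h : q ∣ a * c * (k + 1)) :
    Function.Periodic (divCount k a b c q) c := by
  intro n
  have h1 := divCount_add_step k a b c q n
  have h2 : q ∣ b + a * (n + (k + 1) * c) ↔ q ∣ b + a * n := by
    have : b + a * (n + (k + 1) * c) = b + a * n + a * c * (k + 1) := by ring
    rw [this]; exact Nat.dvd_add_left h
  simp only [h2] at h1
  omega

theorem dvd_Lk {k i : ℕ} (h1 : 1 ≤ i) (h2 : i ≤ k) : i ∣ Lk k :=
  Finset.dvd_lcm (f := id) (Finset.mem_Icc.2 ⟨h1, h2⟩)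

theorem Lk_ne_zero (k : ℕ) : Lk k ≠ 0 := by
  unfold Lk
  rw [Ne, Finset.lcm_eq_zero_iff]
  simp

theorem divCount_le_one {k a b c q : ℕ} (h : ¬ q ∣ a * c * Lk k) (n : ℕ) :
    divCount k a b c q n ≤ 1 := by
  unfold divCount
  by_contra! hc
  obtain ⟨i, hi, j, hj, hij⟩ := Finset.one_lt_card.1 hc
  wlog hlt : i < j generalizing i j
  · exact this j hj i hi hij.symm (by omega)
  simp only [Finset.mem_filter, Finset.mem_range] at hi hj
  apply h
  obtain ⟨s, rfl⟩ := Nat.exists_eq_add_of_lt hlt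
  have h1 : b + a * (n + (i + s + 1) * c) = b + a * (n + i * c) + a * c * (s + 1) := by ring
  rw [h1] at hj
  exact ((Nat.dvd_add_right hi.2).1 hj.2).trans (mul_dvd_mul_left _ (dvd_Lk (by omega) (by omega)))

theorem pow_dvd_finset_lcm_iff {ι : Type*} {p j : ℕ} (hp : p.Prime) (hj : 1 ≤ j)
    (s : Finset ι) (x : ι → ℕ) (hx : ∀ i ∈ s, x i ≠ 0) :
    p ^ j ∣ s.lcm x ↔ ∃ i ∈ s, p ^ j ∣ x i := by
  classical
  induction s using Finset.induction_on with
  | empty =>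
    simp only [Finset.lcm_empty, Nat.dvd_one, Finset.notMem_empty, false_and, exists_false, iff_false]
    exact (Nat.one_lt_pow (by omega) hp.one_lt).ne'
  | insert i s hi ih =>
    have h0 : s.lcm x ≠ 0 := by
      rw [Ne, Finset.lcm_eq_zero_iff]
      rintro ⟨i, hi, h⟩
      exact hx i (Finset.mem_insert_of_mem hi) h
    have hi0 := hx i (Finset.mem_insert_self i s)
    rw [Finset.lcm_insert, Finset.exists_mem_insert,
      ← ih fun i hi => hx i (Finset.mem_insert_of_mem hi)]
    change p ^ j ∣ Nat.lcm (x i) (s.lcm x) ↔ _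
    rw [hp.pow_dvd_iff_le_factorization (Nat.lcm_ne_zero hi0 h0),
      hp.pow_dvd_iff_le_factorization hi0, hp.pow_dvd_iff_le_factorization h0,
      Nat.factorization_lcm hi0 h0, Finsupp.sup_apply, le_sup_iff]

theorem padicValNat_Lk {p k : ℕ} (hp : p.Prime) : padicValNat p (Lk k) = Nat.log p k := by
  have := Fact.mk hp
  refine eq_of_forall_le_iff fun j => ?_
  rcases Nat.eq_zero_or_pos j with rfl | hj
  · simp
  rw [← padicValNat_dvd_iff_le (Lk_ne_zero k), Lk,
    pow_dvd_finset_lcm_iff hp hj _ _ fun i hi => by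
      have := (Finset.mem_Icc.1 hi).1
      simp; omega]
  constructor
  · rintro ⟨i, hi, h⟩
    have hi := Finset.mem_Icc.1 hi
    exact Nat.le_log_of_pow_le hp.one_lt ((Nat.le_of_dvd hi.1 h).trans hi.2)
  · intro h
    have hk : k ≠ 0 := by rintro rfl; simp at h; omega
    exact ⟨p ^ j, Finset.mem_Icc.2 ⟨Nat.one_le_pow _ _ hp.pos, Nat.pow_le_of_le_log hk h⟩,
      dvd_rfl⟩

theorem divCount_eq_zero_iff {k a b c q n : ℕ} :
    divCount k a b c q n = 0 ↔ ∀ i ≤ k, ¬ q ∣ b + a * (n + i * c) := by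
  simp [divCount, Finset.filter_eq_empty_iff]

theorem two_le_divCount {k a b c q n m : ℕ} (hm : 1 ≤ m) (hmk : m ≤ k) (h0 : q ∣ b + a * n)
    (hq : q ∣ a * c * m) : 2 ≤ divCount k a b c q n := by
  unfold divCount
  refine Finset.one_lt_card.2 ⟨0, ?_, m, ?_, by omega⟩
  · simpa using h0
  · simp only [Finset.mem_filter, Finset.mem_range]
    refine ⟨by omega, ?_⟩
    have : b + a * (n + m * c) = b + a * n + a * c * m := by ring
    rw [this]
    exact dvd_add h0 hq

/-! ### Local factors -/

theorem localFactor_ne_zero {p : ℕ} (hp : p.Prime) (k a b c K n : ℕ) :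
    localFactor k a b c K p n ≠ 0 := by
  refine Finset.prod_ne_zero_iff.2 fun j _ => pow_ne_zero _ ?_
  have := hp.two_le
  unfold phiRatio
  split_ifs <;> omega

theorem localFactor_periodic {k a b c K p T : ℕ}
    (h : ∀ j, 1 ≤ j → phiRatio p j = 1 ∨ p ^ j ∣ a * T ∨
      Function.Periodic (divCount k a b c (p ^ j)) T ∨ ¬ p ^ j ∣ a * c * Lk k) :
    Function.Periodic (localFactor k a b c K p) T := by
  intro n
  refine Finset.prod_congr rfl fun j hj => ?_
  rcases h j (Finset.mem_Icc.1 hj).1 with h | h | h | h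
  · simp [h]
  · rw [divCount_periodic_of_dvd h n]
  · rw [h n]
  · have h1 := divCount_le_one (b := b) h (n + T)
    have h2 := divCount_le_one (b := b) h n
    rw [Nat.sub_eq_zero_of_le h1, Nat.sub_eq_zero_of_le h2]

/-- Equality of local factors is equality of the exponents of `p` (and of `p - 1` if `p ≠ 2`). -/
theorem sum_eq_of_localFactor_eq {k a b c K p n n' : ℕ} (hp : p.Prime) (hK : 1 ≤ K)
    (h : localFactor k a b c K p n = localFactor k a b c K p n') :
    ∑ j ∈ Finset.Icc (if p = 2 then 2 else 1) K, (divCount k a b c (p ^ j) n - 1) =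
      ∑ j ∈ Finset.Icc (if p = 2 then 2 else 1) K, (divCount k a b c (p ^ j) n' - 1) := by
  have key : ∀ m, localFactor k a b c K p m = (p - 1) ^ (divCount k a b c p m - 1) *
      p ^ (∑ j ∈ Finset.Icc 2 K, (divCount k a b c (p ^ j) m - 1)) := by
    intro m
    rw [localFactor, ← Finset.mul_prod_Ioc_eq_prod_Icc hK, ← Finset.prod_pow_eq_pow_sum]
    congr 1
    · simp [phiRatio]
    · have : Finset.Ioc 1 K = Finset.Icc 2 K := by ext; simp [Nat.succ_le_iff]
      rw [this]
      refine Finset.prod_congr rfl fun j hj => ?_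
      have := (Finset.mem_Icc.1 hj).1
      rw [phiRatio, if_neg (by omega)]
  rw [key, key] at h
  have h2 := hp.two_le
  -- As p does not divide p - 1, the p-valuation isolates the levels j ≥ 2. Level 1 is then
  -- recovered from the power of p - 1, except when p = 2 and that base is 1.
  have hnd : ∀ s, padicValNat p ((p - 1) ^ s) = 0 := fun s =>
    padicValNat.eq_zero_of_not_dvd fun hd =>
      absurd (Nat.le_of_dvd (by omega) (hp.dvd_of_dvd_pow hd)) (by omega)
  have := Fact.mk hp
  have hs := congrArg (padicValNat p) h
  rw [padicValNat.mul (pow_ne_zero _ (by omega)) (pow_ne_zero _ (by omega)),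
    padicValNat.mul (pow_ne_zero _ (by omega)) (pow_ne_zero _ (by omega)), hnd, hnd,
    padicValNat.prime_pow, padicValNat.prime_pow, zero_add, zero_add] at hs
  split_ifs with hp2
  · exact hs
  · rw [hs] at h
    have h1 := Nat.eq_of_mul_eq_mul_right (pow_pos hp.pos _) h
    have h3 := Nat.pow_right_injective (show 2 ≤ p - 1 by omega) h1
    rw [← Finset.add_sum_Ioc_eq_sum_Icc hK, ← Finset.add_sum_Ioc_eq_sum_Icc hK]
    have : Finset.Ioc 1 K = Finset.Icc 2 K := by ext; simp [Nat.succ_le_iff]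
    rw [this, hs, pow_one, h3]

theorem exists_pow_dvd_add_mul {p D α b : ℕ} (hp : p.Prime) (hα : ¬ p ∣ α) (hb : p ^ D ∣ b)
    (E : ℕ) : ∃ n, p ^ E ∣ b + p ^ D * α * n := by
  obtain ⟨β, rfl⟩ := hb
  have hcop : Nat.Coprime α (p ^ E) := ((Nat.Prime.coprime_iff_not_dvd hp).2 hα).symm.pow_right E
  -- The target residue (p^E - 1)β stands for -β modulo p^E.
  obtain ⟨m, -, hm⟩ := Nat.exists_mul_mod_eq_of_coprime ((p ^ E - 1) * β) hcop
    (pow_ne_zero _ hp.ne_zero)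
  refine ⟨m, ?_⟩
  have h1 : p ^ E ∣ β + α * m := by
    rw [Nat.dvd_iff_mod_eq_zero, Nat.add_mod, hm, ← Nat.add_mod]
    have h2 : β + (p ^ E - 1) * β = p ^ E * β := by
      obtain ⟨t, ht⟩ := Nat.exists_eq_add_of_le' (Nat.one_le_pow E p hp.pos)
      rw [ht, Nat.add_sub_cancel]
      ring
    rw [h2, Nat.mul_mod_right]
  have h3 : p ^ D * β + p ^ D * α * m = p ^ D * (β + α * m) := by ring
  rw [h3]
  exact h1.mul_left _

/-! ### Periods and non-periods at a prime not dividing a' -/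

/-- The shape of the data at a prime `p` not dividing `a / gcd(a, b)`. -/
structure LocalData (k a b c K p δ γ α κ : ℕ) : Prop where
  prime : p.Prime
  a_eq : a = p ^ δ * α
  not_dvd_α : ¬ p ∣ α
  c_eq : c = p ^ γ * κ
  not_dvd_κ : ¬ p ∣ κ
  dvd_b : p ^ δ ∣ b
  one_le_k : 1 ≤ k
  le_K : δ + γ + Nat.log p k ≤ K

namespace LocalData

variable {k a b c K p δ γ α κ : ℕ}

theorem dvd_a_mul_iff (h : LocalData k a b c K p δ γ α κ) (s m : ℕ) :
    p ^ (δ + s) ∣ a * m ↔ p ^ s ∣ m := by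
  rw [h.a_eq, pow_add, mul_assoc, Nat.mul_dvd_mul_iff_left (pow_pos h.prime.pos _)]
  exact ((Nat.Prime.coprime_iff_not_dvd h.prime).2 h.not_dvd_α).pow_left s |>.dvd_mul_left

theorem dvd_ac_mul_iff (h : LocalData k a b c K p δ γ α κ) (s m : ℕ) :
    p ^ (δ + γ + s) ∣ a * c * m ↔ p ^ s ∣ m := by
  rw [add_assoc, mul_assoc, h.dvd_a_mul_iff, h.c_eq, pow_add, mul_assoc,
    Nat.mul_dvd_mul_iff_left (pow_pos h.prime.pos _)]
  exact ((Nat.Prime.coprime_iff_not_dvd h.prime).2 h.not_dvd_κ).pow_left s |>.dvd_mul_left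

theorem pow_log_le (h : LocalData k a b c K p δ γ α κ) : p ^ Nat.log p k ≤ k :=
  Nat.pow_log_le_self p (by have := h.one_le_k; omega)

theorem le_of_dvd_mul_Lk (h : LocalData k a b c K p δ γ α κ) {j : ℕ}
    (hj : p ^ j ∣ a * c * Lk k) : j ≤ δ + γ + Nat.log p k := by
  by_contra! hc
  have h1 : p ^ (δ + γ + (Nat.log p k + 1)) ∣ a * c * Lk k := (pow_dvd_pow p (by omega)).trans hj
  rw [h.dvd_ac_mul_iff] at h1
  have := Fact.mk h.prime
  rw [padicValNat_dvd_iff_le (Lk_ne_zero k), padicValNat_Lk h.prime] at h1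
  omega

theorem periodic_of_le (h : LocalData k a b c K p δ γ α κ) {j s : ℕ} (hj : j ≤ δ + s) :
    Function.Periodic (divCount k a b c (p ^ j)) (p ^ s) :=
  divCount_periodic_of_dvd ((pow_dvd_pow p hj).trans ((h.dvd_a_mul_iff s _).2 dvd_rfl))

theorem localFactor_periodic_full (h : LocalData k a b c K p δ γ α κ) :
    Function.Periodic (localFactor k a b c K p) (p ^ (γ + Nat.log p k)) := by
  refine localFactor_periodic fun j _ => ?_
  by_cases hj : j ≤ δ + (γ + Nat.log p k)
  · exact Or.inr (Or.inr (Or.inl (h.periodic_of_le hj)))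
  · exact Or.inr (Or.inr (Or.inr fun hd => hj (by have := h.le_of_dvd_mul_Lk hd; omega)))

/-- Each relevant count has both c and p^j as periods, hence also their gcd, which is p^γ once j >
γ. -/
theorem localFactor_periodic_of_dvd (h : LocalData k a b c K p δ γ α κ)
    (hd : p ^ Nat.log p k ∣ k + 1) :
    Function.Periodic (localFactor k a b c K p) (p ^ γ) := by
  refine localFactor_periodic fun j _ => ?_
  by_cases hj : j ≤ δ + γ + Nat.log p k
  · refine Or.inr (Or.inr (Or.inl ?_))
    have h1 : Function.Periodic (divCount k a b c (p ^ j)) c :=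
      divCount_periodic_step ((pow_dvd_pow p hj).trans ((h.dvd_ac_mul_iff _ _).2 hd))
    have h2 := h.periodic_of_le (show j ≤ δ + j by omega)
    by_cases hjγ : j ≤ γ
    · exact h2.of_dvd_nat (pow_dvd_pow p hjγ)
    · have h3 : Nat.gcd c (p ^ j) = p ^ γ := by
        obtain ⟨t, rfl⟩ := Nat.exists_eq_add_of_le (show γ ≤ j by omega)
        rw [h.c_eq, pow_add, Nat.gcd_mul_left]
        have : Nat.Coprime κ (p ^ t) :=
          ((Nat.Prime.coprime_iff_not_dvd h.prime).2 h.not_dvd_κ).symm.pow_right t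
        rw [this.gcd_eq_one, mul_one]
      rw [← h3]
      exact h1.natGcd _ _ h2
  · exact Or.inr (Or.inr (Or.inr fun hd => hj (h.le_of_dvd_mul_Lk hd)))

theorem localFactor_periodic_two (h : LocalData k a b c K p δ γ α κ) (hp : p = 2)
    (hlt : δ + γ + Nat.log p k ≤ 1) :
    Function.Periodic (localFactor k a b c K p) 1 := by
  refine localFactor_periodic fun j hj => ?_
  rcases hj.eq_or_lt with rfl | hj
  · left; simp [phiRatio, hp]
  · exact Or.inr (Or.inr (Or.inr fun hd => by have := h.le_of_dvd_mul_Lk hd; omega))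

/-- The terms with indices 0 and p^e are both divisible by the top power. -/
theorem exists_top (h : LocalData k a b c K p δ γ α κ) :
    ∃ n, p ^ (δ + γ + Nat.log p k) ∣ b + a * n ∧
      2 ≤ divCount k a b c (p ^ (δ + γ + Nat.log p k)) n := by
  obtain ⟨n, hn⟩ := exists_pow_dvd_add_mul h.prime h.not_dvd_α h.dvd_b (δ + γ + Nat.log p k)
  rw [← h.a_eq] at hn
  exact ⟨n, hn, two_le_divCount (Nat.one_le_pow _ _ h.prime.pos) h.pow_log_le hn
    ((h.dvd_ac_mul_iff _ _).2 dvd_rfl)⟩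

theorem mem_Icc (h : LocalData k a b c K p δ γ α κ)
    (hr : (if p = 2 then 2 else 1) ≤ δ + γ + Nat.log p k) :
    δ + γ + Nat.log p k ∈ Finset.Icc (if p = 2 then 2 else 1) K :=
  Finset.mem_Icc.2 ⟨hr, h.le_K⟩

theorem one_le_K (h : LocalData k a b c K p δ γ α κ)
    (hr : (if p = 2 then 2 else 1) ≤ δ + γ + Nat.log p k) : 1 ≤ K := by
  have := h.le_K
  split_ifs at hr <;> omega

/-- At the witness, shifting by p^(γ-1) empties every level j ≥ δ + γ and leaves the lower ones
unchanged, so the exponent sum strictly drops. -/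
theorem not_periodic_of_dvd (h : LocalData k a b c K p δ γ α κ)
    (hr : (if p = 2 then 2 else 1) ≤ δ + γ + Nat.log p k) (hγ : 1 ≤ γ) :
    ¬ Function.Periodic (localFactor k a b c K p) (p ^ (γ - 1)) := by
  intro hper
  obtain ⟨n, hn, hn2⟩ := h.exists_top
  have hzero : ∀ j, δ + γ ≤ j → divCount k a b c (p ^ j) (n + p ^ (γ - 1)) = 0 := by
    intro j hj
    rw [divCount_eq_zero_iff]
    intro i _ hi
    have h1 : p ^ (δ + γ) ∣ b + a * n + a * c * i + a * p ^ (γ - 1) := by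
      have : b + a * n + a * c * i + a * p ^ (γ - 1) = b + a * (n + p ^ (γ - 1) + i * c) := by ring
      rw [this]
      exact (pow_dvd_pow p hj).trans hi
    have h2 : p ^ (δ + γ) ∣ b + a * n + a * c * i := by
      refine dvd_add ((pow_dvd_pow p (by omega)).trans hn) ?_
      simpa using (h.dvd_ac_mul_iff 0 i).2 (by simp)
    have h3 := (h.dvd_a_mul_iff γ _).1 ((Nat.dvd_add_right h2).1 h1)
    have := (Nat.pow_dvd_pow_iff_le_right h.prime.one_lt).1 h3
    omega
  refine (sum_eq_of_localFactor_eq h.prime (h.one_le_K hr) (hper n)).not_lt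
    (Finset.sum_lt_sum (fun j _ => ?_) ⟨_, h.mem_Icc hr, ?_⟩)
  · by_cases hj : j ≤ δ + (γ - 1)
    · rw [h.periodic_of_le hj n]
    · rw [hzero j (by omega)]; omega
  · rw [hzero _ (by omega)]; omega

/-- Lower levels already have period T and higher ones contribute nothing, so the truncated top
count would have period T. Sliding by c from n lowers that count, which is at least 2. From n + T no
multiple leaves the window, so the count cannot drop there. -/
theorem not_periodic_of_not_dvd (h : LocalData k a b c K p δ γ α κ)
    (hr : (if p = 2 then 2 else 1) ≤ δ + γ + Nat.log p k) (hd : ¬ p ^ Nat.log p k ∣ k + 1) :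
    ¬ Function.Periodic (localFactor k a b c K p) (p ^ (γ + Nat.log p k - 1)) := by
  intro hper
  obtain ⟨n, hn, hn2⟩ := h.exists_top
  have he : 1 ≤ Nat.log p k := by
    by_contra! h0
    rw [Nat.lt_one_iff.1 h0] at hd
    simp at hd
  set e := Nat.log p k with hedef
  set T := p ^ (γ + e - 1) with hT
  have hu : ∀ m, divCount k a b c (p ^ (δ + γ + e)) (m + T) - 1 =
      divCount k a b c (p ^ (δ + γ + e)) m - 1 := by
    intro m
    have h1 := sum_eq_of_localFactor_eq h.prime (h.one_le_K hr) (hper m)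
    rw [← Finset.add_sum_erase _ _ (h.mem_Icc hr), ← Finset.add_sum_erase _ _ (h.mem_Icc hr)] at h1
    have h2 : ∀ j ∈ (Finset.Icc (if p = 2 then 2 else 1) K).erase (δ + γ + e),
        divCount k a b c (p ^ j) (m + T) - 1 = divCount k a b c (p ^ j) m - 1 := by
      intro j hj
      have hne := Finset.ne_of_mem_erase hj
      by_cases hj' : j ≤ δ + (γ + e - 1)
      · rw [h.periodic_of_le hj' m]
      · have hnd : ¬ p ^ j ∣ a * c * Lk k := fun hd => by
          have := h.le_of_dvd_mul_Lk hd
          omega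
        have h3 := divCount_le_one (b := b) hnd (m + T)
        have h4 := divCount_le_one (b := b) hnd m
        omega
    rw [Finset.sum_congr rfl h2] at h1
    exact Nat.add_right_cancel h1
  have hnk : ¬ p ^ (δ + γ + e) ∣ b + a * (n + (k + 1) * c) := by
    have : b + a * (n + (k + 1) * c) = b + a * n + a * c * (k + 1) := by ring
    rw [this, Nat.dvd_add_right hn, h.dvd_ac_mul_iff]
    exact hd
  have hnT : ¬ p ^ (δ + γ + e) ∣ b + a * (n + T) := by
    have : b + a * (n + T) = b + a * n + a * T := by ring
    rw [this, Nat.dvd_add_right hn, add_assoc, h.dvd_a_mul_iff,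
      Nat.pow_dvd_pow_iff_le_right h.prime.one_lt]
    omega
  have s1 := divCount_add_step k a b c (p ^ (δ + γ + e)) n
  have s2 := divCount_add_step k a b c (p ^ (δ + γ + e)) (n + T)
  rw [if_pos hn, if_neg hnk] at s1
  rw [if_neg hnT] at s2
  have u1 := hu n
  have u2 := hu (n + c)
  rw [add_right_comm n c T] at u2
  omega

end LocalData

/-- Each term is gcd(a, b) times a number prime to p. -/
theorem localFactor_periodic_of_dvd_div {k a b c K p : ℕ} (ha : 1 ≤ a) (hp : p.Prime)
    (hd : p ∣ a / Nat.gcd a b) : Function.Periodic (localFactor k a b c K p) 1 := by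
  have hg : 0 < Nat.gcd a b := Nat.gcd_pos_of_pos_left _ ha
  obtain ⟨α, hα⟩ := Nat.gcd_dvd_left a b
  obtain ⟨β, hβ⟩ := Nat.gcd_dvd_right a b
  have hα' : a / Nat.gcd a b = α := Nat.div_eq_of_eq_mul_right hg hα
  have hβ' : b / Nat.gcd a b = β := Nat.div_eq_of_eq_mul_right hg hβ
  have hcop : Nat.Coprime α β := by
    rw [← hα', ← hβ']; exact Nat.coprime_div_gcd_div_gcd hg
  rw [hα'] at hd
  have key : ∀ j m, p ^ j ∣ b + a * m ↔ p ^ j ∣ Nat.gcd a b := by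
    intro j m
    have h1 : b + a * m = Nat.gcd a b * (β + α * m) := by
      rw [mul_add, ← mul_assoc, ← hα, ← hβ]
    rw [h1]
    refine Nat.Coprime.dvd_mul_right (Nat.Coprime.pow_left j ?_)
    rw [Nat.Prime.coprime_iff_not_dvd hp, Nat.dvd_add_left (hd.mul_right m)]
    exact fun h => Nat.not_coprime_of_dvd_of_dvd hp.one_lt hd h hcop
  refine localFactor_periodic fun j _ => Or.inr (Or.inr (Or.inl fun n => ?_))
  simp only [divCount, key]

/-! ### The exact local period -/

/-- The exponent of `p` in the smallest period of `g_{k,φ}`. -/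
def periodExp (k a b c p : ℕ) : ℕ :=
  if p ∣ a / Nat.gcd a b then 0
  else if p = 2 ∧ ¬ 2 ∣ Nat.gcd a b ∧ padicValNat p c + Nat.log p k ≤ 1 then 0
  else if p ^ Nat.log p k ∣ k + 1 then padicValNat p c
  else padicValNat p c + Nat.log p k

theorem exists_eq_pow_mul_not_dvd {p n : ℕ} (hp : p.Prime) (hn : n ≠ 0) :
    ∃ m, n = p ^ padicValNat p n * m ∧ ¬ p ∣ m := by
  have := Fact.mk hp
  obtain ⟨m, hm⟩ := pow_padicValNat_dvd (p := p) (n := n)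
  refine ⟨m, hm, fun ⟨t, ht⟩ => pow_succ_padicValNat_not_dvd (p := p) hn ⟨t, ?_⟩⟩
  rw [pow_succ, mul_assoc, ← ht, ← hm]

theorem localFactor_periodic_iff {k a b c p : ℕ} (hk : 1 ≤ k) (ha : 1 ≤ a) (hc : 1 ≤ c)
    (hp : p.Prime) (T : ℕ) :
    Function.Periodic (localFactor k a b c (a * c * Lk k) p) T ↔ p ^ periodExp k a b c p ∣ T := by
  have := Fact.mk hp
  by_cases hd : p ∣ a / Nat.gcd a b
  · refine periodic_iff_pow_dvd hp ?_ ?_ T <;> simp only [periodExp, if_pos hd]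
    · exact localFactor_periodic_of_dvd_div ha hp hd
    · intro h; omega
  have hg : Nat.gcd a b ≠ 0 := (Nat.gcd_pos_of_pos_left _ ha).ne'
  obtain ⟨α, hα, hpα⟩ := exists_eq_pow_mul_not_dvd hp (show a ≠ 0 by omega)
  obtain ⟨κ, hκ, hpκ⟩ := exists_eq_pow_mul_not_dvd hp (show c ≠ 0 by omega)
  have hδ : padicValNat p (Nat.gcd a b) = padicValNat p a := by
    have h1 : a = Nat.gcd a b * (a / Nat.gcd a b) := (Nat.mul_div_cancel' (Nat.gcd_dvd_left a b)).symm
    have h2 : a / Nat.gcd a b ≠ 0 := fun h => hd (h ▸ dvd_zero p)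
    conv_rhs => rw [h1]
    rw [padicValNat.mul hg h2, padicValNat.eq_zero_of_not_dvd hd, add_zero]
  have hD : LocalData k a b c (a * c * Lk k) p (padicValNat p a) (padicValNat p c) α κ := by
    refine ⟨hp, hα, hpα, hκ, hpκ, ?_, hk, ?_⟩
    · rw [← hδ]; exact pow_padicValNat_dvd.trans (Nat.gcd_dvd_right a b)
    · rw [← padicValNat_Lk hp, ← padicValNat.mul (by omega) (by omega),
        ← padicValNat.mul (Nat.mul_ne_zero (by omega) (by omega)) (Lk_ne_zero k)]
      exact (padicValNat_le_nat_log _).trans (Nat.log_le_self _ _)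
  have hδ2 : p ∣ Nat.gcd a b ↔ 1 ≤ padicValNat p a := by
    rw [← hδ, ← padicValNat_dvd_iff_le hg, pow_one]
  refine periodic_iff_pow_dvd hp ?_ ?_ T <;> simp only [periodExp, if_neg hd]
  · split_ifs with h1 h2
    · obtain ⟨rfl, h1, h3⟩ := h1
      exact hD.localFactor_periodic_two rfl (by omega)
    · exact hD.localFactor_periodic_of_dvd h2
    · exact hD.localFactor_periodic_full
  · split_ifs with h1 h2
    · omega
    · intro h
      refine hD.not_periodic_of_dvd ?_ h
      split_ifs with hp2
      · subst hp2
        omega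
      · omega
    · intro h
      refine hD.not_periodic_of_not_dvd ?_ h2
      split_ifs with hp2
      · subst hp2
        omega
      · omega

/-! ### Factoring g into local factors -/

theorem prod_Icc_phiRatio {p : ℕ} (hp : p.Prime) (v : ℕ) :
    ∏ j ∈ Finset.Icc 1 v, phiRatio p j = Nat.totient (p ^ v) := by
  induction v with
  | zero => simp
  | succ v ih =>
    rw [Finset.prod_Icc_succ_top (by omega), ih, phiRatio]
    rcases Nat.eq_zero_or_pos v with rfl | hv
    · simp [Nat.totient_prime hp]
    · rw [if_neg (by omega), Nat.totient_prime_pow hp hv, Nat.totient_prime_pow hp (by omega)]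
      obtain ⟨t, rfl⟩ := Nat.exists_eq_add_of_le' hv
      simp only [Nat.add_sub_cancel]
      ring

theorem totient_eq_prod_phiRatio {x J : ℕ} {S : Finset ℕ} (hx : x ≠ 0) (hS : ∀ p ∈ S, p.Prime)
    (hxS : x.primeFactors ⊆ S) (hJ : x ≤ J) :
    Nat.totient x = ∏ p ∈ S, ∏ j ∈ Finset.Icc 1 J, if p ^ j ∣ x then phiRatio p j else 1 := by
  rw [Nat.multiplicative_factorization Nat.totient (fun _ _ h => Nat.totient_mul h)
    Nat.totient_one hx, Finsupp.prod_of_support_subset _ (by simpa using hxS) _ (by simp)]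
  refine Finset.prod_congr rfl fun p hp => ?_
  have hp' := hS p hp
  rw [← prod_Icc_phiRatio hp', ← Finset.prod_filter]
  refine Finset.prod_congr ?_ fun _ _ => rfl
  ext j
  have h1 : x.factorization p ≤ x := (Nat.factorization_lt p hx).le
  simp only [Finset.mem_Icc, Finset.mem_filter, hp'.pow_dvd_iff_le_factorization hx]
  omega

/-- A power p^j divides the lcm exactly when it divides some term, so the lcm absorbs one copy of
`phiRatio p j` at each nonempty level. -/
theorem prod_totient_eq {ι : Type*} {s : Finset ι} {x : ι → ℕ} {J : ℕ} {S : Finset ℕ}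
    (hx : ∀ i ∈ s, x i ≠ 0) (hS : ∀ p ∈ S, p.Prime) (hxS : (s.lcm x).primeFactors ⊆ S)
    (hJ : s.lcm x ≤ J) :
    ∏ i ∈ s, Nat.totient (x i) = Nat.totient (s.lcm x) *
      ∏ p ∈ S, ∏ j ∈ Finset.Icc 1 J,
        phiRatio p j ^ ((s.filter fun i => p ^ j ∣ x i).card - 1) := by
  have h0 : s.lcm x ≠ 0 := by
    rw [Ne, Finset.lcm_eq_zero_iff]
    rintro ⟨i, hi, h⟩
    exact hx i hi h
  have h1 : ∀ i ∈ s, Nat.totient (x i) =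
      ∏ p ∈ S, ∏ j ∈ Finset.Icc 1 J, if p ^ j ∣ x i then phiRatio p j else 1 := fun i hi =>
    totient_eq_prod_phiRatio (hx i hi) hS
      ((Nat.primeFactors_mono (Finset.dvd_lcm hi) h0).trans hxS)
      ((Nat.le_of_dvd (Nat.pos_of_ne_zero h0) (Finset.dvd_lcm hi)).trans hJ)
  rw [Finset.prod_congr rfl h1, totient_eq_prod_phiRatio h0 hS hxS hJ, Finset.prod_comm,
    ← Finset.prod_mul_distrib]
  refine Finset.prod_congr rfl fun p hp => ?_
  rw [Finset.prod_comm, ← Finset.prod_mul_distrib]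
  refine Finset.prod_congr rfl fun j hj => ?_
  rw [← Finset.prod_filter, Finset.prod_const]
  simp only [pow_dvd_finset_lcm_iff (hS p hp) (Finset.mem_Icc.1 hj).1 s x hx]
  split_ifs with h
  · obtain ⟨i, hi, hd⟩ := h
    rw [← pow_succ', Nat.sub_add_cancel]
    exact Finset.card_pos.2 ⟨i, Finset.mem_filter.2 ⟨hi, hd⟩⟩
  · have : s.filter (fun i => p ^ j ∣ x i) = ∅ :=
      Finset.filter_eq_empty_iff.2 fun i hi hd => h ⟨i, hi, hd⟩
    simp [this]

/-- Writing n = m + 1 turns b into b + a. This leaves gcd(a, b), and so `periodExp`, unchanged. -/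
theorem gPhi_succPNat {k a b c : ℕ} (ha : 1 ≤ a) (hc : 1 ≤ c) (m : ℕ) :
    gPhi k a b c m.succPNat = ((∏ p ∈ (a * c * Lk k).primeFactors,
      localFactor k a (b + a) c (a * c * Lk k) p m : ℕ) : ℚ) := by
  set K := a * c * Lk k with hK
  have hK0 : K ≠ 0 := mul_ne_zero (mul_ne_zero (by omega) (by omega)) (Lk_ne_zero k)
  set x : ℕ → ℕ := fun i => b + a * ((m.succPNat : ℕ) + i * c) with hxdef
  set s := Finset.range (k + 1) with hs
  have hx : ∀ i, x i = (b + a) + a * (m + i * c) := fun i => by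
    simp only [hxdef, Nat.succPNat_coe]; rw [Nat.succ_eq_add_one]; ring
  have hx0 : ∀ i ∈ s, x i ≠ 0 := fun i _ => by rw [hx]; omega
  have h0 : s.lcm x ≠ 0 := by
    rw [Ne, Finset.lcm_eq_zero_iff]
    rintro ⟨i, hi, h⟩
    exact hx0 i hi h
  have hSp : ∀ p ∈ (K * s.lcm x).primeFactors, p.Prime := fun p hp =>
    Nat.prime_of_mem_primeFactors hp
  have h1 := prod_totient_eq hx0 hSp
    (Nat.primeFactors_mono (dvd_mul_left _ _) (mul_ne_zero hK0 h0))
    (Nat.le_of_dvd (Nat.pos_of_ne_zero (mul_ne_zero hK0 h0)) (dvd_mul_left (s.lcm x) K))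
  have hcount : ∀ q, (s.filter fun i => q ∣ x i).card = divCount k a (b + a) c q m := by
    intro q; simp only [divCount, hx, hs]
  have htriv : ∀ p j, ¬ p ^ j ∣ K → phiRatio p j ^ (divCount k a (b + a) c (p ^ j) m - 1) = 1 := by
    intro p j h
    rw [Nat.sub_eq_zero_of_le (divCount_le_one h m), pow_zero]
  have h2 : ∏ p ∈ (K * s.lcm x).primeFactors, ∏ j ∈ Finset.Icc 1 (K * s.lcm x),
        phiRatio p j ^ ((s.filter fun i => p ^ j ∣ x i).card - 1) =
      ∏ p ∈ K.primeFactors, localFactor k a (b + a) c K p m := by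
    simp only [hcount]
    rw [← Finset.prod_subset (Nat.primeFactors_mono (dvd_mul_right K (s.lcm x))
      (mul_ne_zero hK0 h0))]
    · refine Finset.prod_congr rfl fun p hp => ?_
      rw [localFactor]
      symm
      refine Finset.prod_subset (Finset.Icc_subset_Icc_right
        (Nat.le_mul_of_pos_right K (Nat.pos_of_ne_zero h0))) fun j hj hj' => htriv p j fun hd => ?_
      have h3 := Nat.le_of_dvd (Nat.pos_of_ne_zero hK0) hd
      have h4 := Nat.lt_pow_self (Nat.prime_of_mem_primeFactors hp).one_lt (n := j)
      simp only [Finset.mem_Icc] at hj hj'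
      omega
    · intro p hp hp'
      refine Finset.prod_eq_one fun j hj => htriv p j fun hd => hp' ?_
      exact Nat.mem_primeFactors.2 ⟨hSp p hp, (dvd_pow_self p
        (by have := (Finset.mem_Icc.1 hj).1; omega)).trans hd, hK0⟩
  rw [h2] at h1
  rw [gPhi, gFun, div_eq_iff]
  · rw [mul_comm]
    exact_mod_cast h1
  · exact_mod_cast (Nat.totient_pos.2 (Nat.pos_of_ne_zero h0)).ne'

theorem isPeriod_gPhi_iff {k a b c : ℕ} (hk : 1 ≤ k) (ha : 1 ≤ a) (hc : 1 ≤ c) (T : ℕ+) :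
    IsPeriod (gPhi k a b c) T ↔
      ∏ p ∈ (a * c * Lk k).primeFactors, p ^ periodExp k a b c p ∣ (T : ℕ) := by
  have hE : ∀ p, periodExp k a b c p = periodExp k a (b + a) c p := by
    intro p; simp [periodExp]
  simp only [hE]
  rw [← periodic_prod_iff (fun p hp => Nat.prime_of_mem_primeFactors hp)
    (localFactor k a (b + a) c (a * c * Lk k)) _
    (fun p hp n => localFactor_ne_zero (Nat.prime_of_mem_primeFactors hp) _ _ _ _ _ n)
    (fun p hp T => localFactor_periodic_iff hk ha hc (Nat.prime_of_mem_primeFactors hp) T)]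
  constructor
  · intro h m
    have h1 := h m.succPNat
    have h2 : m.succPNat + T = (m + T).succPNat := by
      apply PNat.coe_injective
      simp only [PNat.add_coe, Nat.succPNat_coe]
      omega
    rw [h2, gPhi_succPNat ha hc, gPhi_succPNat ha hc] at h1
    exact_mod_cast h1
  · intro h n
    obtain ⟨m, rfl⟩ : ∃ m, n = Nat.succPNat m := ⟨n.natPred, (PNat.succPNat_natPred n).symm⟩
    have h2 : m.succPNat + T = (m + T).succPNat := by
      apply PNat.coe_injective
      simp only [PNat.add_coe, Nat.succPNat_coe]
      omega
    rw [h2, gPhi_succPNat ha hc, gPhi_succPNat ha hc]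
    exact_mod_cast h m

/-! ### Comparison with the closed form -/

theorem IsExceptional.eq {k a b p q : ℕ} (hk : 1 ≤ k) (hp : IsExceptional k a b p)
    (hq : IsExceptional k a b q) : p = q := by
  have aux : ∀ p q, IsExceptional k a b p → IsExceptional k a b q → p ≠ q → q ≤ p := by
    rintro p q ⟨hp, -, -, hp1, hp2⟩ ⟨hq, -, -, hq1, hq2⟩ hne
    have := Fact.mk hp
    have := Fact.mk hq
    rw [padicValNat_Lk hp] at hp1 hp2
    rw [padicValNat_Lk hq] at hq1 hq2
    rw [← padicValNat_dvd_iff_le (by omega)] at hp1 hq1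
    -- With e and f the exponents at p and q, p^e·q^f ≤ k + 1 ≤ p^(e+1), hence q ≤ q^f ≤ p. By
    -- symmetry p = q.
    have h1 := Nat.le_of_dvd (by omega) (Nat.Coprime.mul_dvd_of_dvd_of_dvd
      (Nat.Coprime.pow _ _ ((Nat.coprime_primes hp hq).2 hne)) hp1 hq1)
    have h2 : k < p ^ (Nat.log p k + 1) := Nat.lt_pow_succ_log_self hp.one_lt k
    rw [pow_succ] at h2
    have h3 := Nat.le_of_mul_le_mul_left (h1.trans h2) (pow_pos hp.pos _)
    exact (Nat.le_self_pow (by omega) q).trans h3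
  by_contra hne
  exact hne (le_antisymm (aux q p hq hp (Ne.symm hne)) (aux p q hp hq hne))

/-- The exponent of `2` in `eta2`. -/
def etaExp (k a b c : ℕ) : ℕ :=
  if ¬ 2 ∣ a / Nat.gcd a b ∧
      padicValNat 2 (Lk k) ≤ padicValNat 2 (k + 1) ∧ 2 ≤ padicValNat 2 (Lk k) then
    padicValNat 2 (Lk k)
  else if (¬ 2 ∣ a ∧ padicValNat 2 (c * Lk k) = 1) ∨
      (k = 3 ∧ ¬ 2 ∣ a ∧ 2 ∣ c) ∨
      (k = 3 ∧ ¬ 2 ∣ a / Nat.gcd a b ∧ 2 ∣ Nat.gcd a b) then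
    1
  else 0

theorem eta2_eq_two_pow (k a b c : ℕ) : eta2 k a b c = 2 ^ etaExp k a b c := by
  unfold eta2 etaExp
  split_ifs <;> simp

theorem eq_three_iff {k : ℕ} (hk : 1 ≤ k) :
    k = 3 ↔ Nat.log 2 k = 1 ∧ 1 ≤ padicValNat 2 (k + 1) := by
  rw [← padicValNat_dvd_iff_le (by omega), Nat.log_eq_one_iff']
  omega

-- At p = 2, the condition k = 3 says that e = 1 and k + 1 is even. All cases then become linear
-- arithmetic in e, v_2(c) and v_2(k+1).
open Classical in
theorem padicValNat_mul_Lk {k a b c p : ℕ} (hk : 1 ≤ k) (hc : 1 ≤ c)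
    (hp : p.Prime) :
    padicValNat p (c * Lk k) = periodExp k a b c p + (if p = 2 then etaExp k a b c else 0) +
      (if p ∣ a / Nat.gcd a b then padicValNat p (c * Lk k) else 0) +
      (if IsExceptional k a b p then padicValNat p (Lk k) else 0) := by
  have := Fact.mk hp
  have hdvd : p ^ Nat.log p k ∣ k + 1 ↔ Nat.log p k ≤ padicValNat p (k + 1) :=
    padicValNat_dvd_iff_le (by omega)
  by_cases hp2 : p = 2
  · subst hp2
    have h2a : 2 ∣ a ↔ 2 ∣ a / Nat.gcd a b ∨ 2 ∣ Nat.gcd a b := by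
      rw [← hp.dvd_mul, Nat.div_mul_cancel (Nat.gcd_dvd_left a b)]
    have h2c : 2 ∣ c ↔ 1 ≤ padicValNat 2 c := by
      rw [← padicValNat_dvd_iff_le (by omega), pow_one]
    simp only [periodExp, etaExp, IsExceptional, hdvd, eq_three_iff hk, h2a, h2c,
      padicValNat.mul (show c ≠ 0 by omega) (Lk_ne_zero k), padicValNat_Lk hp]
    generalize Nat.log 2 k = e
    generalize padicValNat 2 c = γ
    generalize padicValNat 2 (k + 1) = v
    by_cases h1 : 2 ∣ a / Nat.gcd a b
    · simp [h1]
    · by_cases h3 : 2 ∣ Nat.gcd a b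
      · simp only [h1, h3]
        simp
        split_ifs <;> omega
      · simp only [h1, h3]
        simp
        split_ifs <;> omega
  · simp only [periodExp, IsExceptional, hdvd, hp2, hp,
      padicValNat.mul (show c ≠ 0 by omega) (Lk_ne_zero k), padicValNat_Lk hp]
    by_cases h1 : p ∣ a / Nat.gcd a b
    · simp [h1]
    · simp [h1]
      split_ifs <;> omega

theorem prod_pow_padicValNat {n : ℕ} {S : Finset ℕ} (hn : n ≠ 0) (hS : n.primeFactors ⊆ S) :
    ∏ p ∈ S, p ^ n.factorization p = n := by
  conv_rhs => rw [← Nat.prod_factorization_pow_eq_self hn]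
  exact (Finsupp.prod_of_support_subset _ (by simpa using hS) _ (by simp)).symm

theorem prod_pow_ite_eq {S : Finset ℕ} {q s : ℕ} (h : q ∉ S → s = 0) :
    ∏ p ∈ S, p ^ (if p = q then s else 0) = q ^ s := by
  rw [Finset.prod_eq_single q (fun p _ hp => by simp [hp]) (fun hq => by simp [h hq])]
  simp

/-- The pair (q, s) covers both cases at once: (1, 0) without an exceptional prime, (p, v_p(L_k))
with one. -/
theorem prod_pow_periodExp_mul {k a b c : ℕ} (hk : 1 ≤ k) (ha : 1 ≤ a) (hc : 1 ≤ c) (q s : ℕ)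
    (hq : ∀ p, IsExceptional k a b p → p = q ∧ s = padicValNat p (Lk k))
    (hs : s ≠ 0 → IsExceptional k a b q) :
    (∏ p ∈ (a * c * Lk k).primeFactors, p ^ periodExp k a b c p) * (eta2 k a b c *
      ∏ p ∈ (a / Nat.gcd a b).primeFactors, p ^ padicValNat p (c * Lk k)) * q ^ s = c * Lk k := by
  classical
  have hL := Lk_ne_zero k
  have hcL : c * Lk k ≠ 0 := mul_ne_zero (by omega) hL
  have hK : a * c * Lk k ≠ 0 := mul_ne_zero (mul_ne_zero (by omega) (by omega)) hL
  have hga : a / Nat.gcd a b ∣ a := Nat.div_dvd_of_dvd (Nat.gcd_dvd_left a b)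
  set S := (a * c * Lk k).primeFactors with hS
  have hmem : ∀ p, p.Prime → p ∉ S → padicValNat p (c * Lk k) = 0 := fun p hp h =>
    padicValNat.eq_zero_of_not_dvd fun hd => h (Nat.mem_primeFactors.2 ⟨hp, hd.trans
      ⟨a, by ring⟩, hK⟩)
  have h1 := prod_pow_padicValNat hcL (Nat.primeFactors_mono (⟨a, by ring⟩ : c * Lk k ∣ a * c * Lk k) hK)
  rw [eta2_eq_two_pow, ← prod_pow_ite_eq (S := S) (q := 2) (s := etaExp k a b c),
    ← prod_pow_ite_eq (S := S) (q := q) (s := s)]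
  · have h2 : ∏ p ∈ (a / Nat.gcd a b).primeFactors, p ^ padicValNat p (c * Lk k) =
        ∏ p ∈ S, p ^ (if p ∣ a / Nat.gcd a b then padicValNat p (c * Lk k) else 0) := by
      have hsub : (a / Nat.gcd a b).primeFactors ⊆ S :=
        Nat.primeFactors_mono (hga.trans ⟨c * Lk k, by ring⟩) hK
      rw [← Finset.prod_subset hsub]
      · refine Finset.prod_congr rfl fun p hp => ?_
        rw [if_pos (Nat.dvd_of_mem_primeFactors hp)]
      · intro p hp hp'
        rw [if_neg, pow_zero]
        exact fun hd => hp' (Nat.mem_primeFactors.2 ⟨Nat.prime_of_mem_primeFactors hp, hd,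
          ne_zero_of_dvd_ne_zero (by omega) hga⟩)
    conv_rhs => rw [← h1]
    rw [h2, ← Finset.prod_mul_distrib, ← Finset.prod_mul_distrib, ← Finset.prod_mul_distrib]
    refine Finset.prod_congr rfl fun p hp => ?_
    have hp' := Nat.prime_of_mem_primeFactors hp
    have h3 : (if p = q then s else 0) =
        if IsExceptional k a b p then padicValNat p (Lk k) else 0 := by
      by_cases he : IsExceptional k a b p
      · obtain ⟨rfl, hs'⟩ := hq p he
        simp [he, hs']
      · rw [if_neg he]
        split_ifs with hpq
        · by_contra h
          exact he (hpq ▸ hs h)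
        · rfl
    rw [h3, ← pow_add, ← pow_add, ← pow_add, Nat.factorization_def _ hp',
      ← add_assoc, ← padicValNat_mul_Lk hk hc hp']
  · intro h
    by_contra hs0
    have he := hs hs0
    have h3 := hmem q he.1 h
    have := Fact.mk he.1
    rw [padicValNat.mul (by omega) hL] at h3
    have := he.2.2.2.2
    omega
  · intro h
    have h3 := padicValNat_mul_Lk (a := a) (b := b) hk hc Nat.prime_two
    rw [hmem 2 Nat.prime_two h, if_pos rfl] at h3
    omega

theorem theorem1p3 (k a b c : ℕ) (hk : 1 ≤ k) (ha : 1 ≤ a) (hc : 1 ≤ c) :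
    (∀ p q : ℕ, IsExceptional k a b p → IsExceptional k a b q → p = q) ∧
    ∃ P : ℕ+, IsLeast {T : ℕ+ | IsPeriod (gPhi k a b c) T} P ∧
      ((∀ p : ℕ, ¬ IsExceptional k a b p) → ((P : ℕ) : ℚ) = Qval k a b c) ∧
      (∀ p : ℕ, IsExceptional k a b p →
        ((P : ℕ) : ℚ) = Qval k a b c / (p : ℚ) ^ padicValNat p (Lk k)) := by
  refine ⟨fun p q hp hq => hp.eq hk hq, ?_⟩
  have hpos : 0 < ∏ p ∈ (a * c * Lk k).primeFactors, p ^ periodExp k a b c p :=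
    Finset.prod_pos fun p hp => pow_pos (Nat.prime_of_mem_primeFactors hp).pos _
  have hη : (eta2 k a b c : ℚ) *
      ∏ q ∈ (a / Nat.gcd a b).primeFactors, (q : ℚ) ^ padicValNat q (c * Lk k) ≠ 0 := by
    refine mul_ne_zero (by rw [eta2_eq_two_pow]; positivity) (Finset.prod_ne_zero_iff.2
      fun q hq => pow_ne_zero _ (Nat.cast_ne_zero.2 (Nat.prime_of_mem_primeFactors hq).ne_zero))
  refine ⟨⟨_, hpos⟩, ⟨(isPeriod_gPhi_iff hk ha hc _).2 dvd_rfl, fun T hT => ?_⟩, fun h => ?_,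
    fun p hp => ?_⟩
  · exact Nat.le_of_dvd T.pos ((isPeriod_gPhi_iff hk ha hc T).1 hT)
  · have h1 := prod_pow_periodExp_mul hk ha hc 1 0 (fun p hp => absurd hp (h p)) (by simp)
    rw [pow_zero, mul_one] at h1
    have h2 := congrArg (Nat.cast (R := ℚ)) h1
    rw [Qval, eq_div_iff hη, ← h2, PNat.mk_coe]
    push_cast
    rfl
  · have h1 := prod_pow_periodExp_mul hk ha hc p (padicValNat p (Lk k))
      (fun q hq => by obtain rfl := hq.eq hk hp; exact ⟨rfl, rfl⟩) (fun _ => hp)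
    have h2 := congrArg (Nat.cast (R := ℚ)) h1
    rw [eq_div_iff (pow_ne_zero _ (Nat.cast_ne_zero.2 hp.1.ne_zero)), Qval, eq_div_iff hη, ← h2,
      PNat.mk_coe]
    push_cast
    ring
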